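/- Let $m\ge 20$ and let $n=\binom m2$ be the number of edges of the complete graph $K_m$ on $m$ labelled vertices. For $x\in\{0,1\}^n$, with coordinates indexed by the edges of $K_m$, let $G_x$ be the subgraph of $K_m$ on all $m$ vertices whose edges are those $e$ with $x_e=1$. Let $d(x)$ be the density (probability mass function) of the uniform distribution over those $x\in\{0,1\}^n$ for which $G_x$ is a spanning tree of $K_m$; that is, $d(x)=1/Z$ if $G_x$ is a spanning tree and $d(x)=0$ otherwise, where $Z$ is the number of spanning trees of $K_m$. Suppose that $d$, or more generally $c\,d$ for some constant $c>0$ (for instance $c=Z$, which gives the $0/1$ indicator of spanning trees), can be written as $$c\,d(x)=\sum_{i=1}^k g_i(y_i)\,h_i(z_i)\qquad\text{for all } x\in\{0,1\}^n,$$ where for each $i$ the tuples $y_i$ and $z_i$ consist of the variables in two disjoint subsets of the variables $x$ whose union is all of $x$, with $\frac n3\le |y_i|,|z_i|\le \frac{2n}3$ (the subsets may depend on $i$), and $g_i$, $h_i$ are arbitrary non-negative real-valued functions of $y_i$ and $z_i$, respectively. Then $$k\ge 2^{m/15120}.$$ -/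

import Mathlib

/-- The edges of the complete graph `K_m` on the vertex set `Fin m`. They label the binary input
variables, so there are `n = m.choose 2` of them. -/
abbrev KEdge (m : ℕ) : Type := (⊤ : SimpleGraph (Fin m)).edgeSet

/-- The spanning subgraph `G_x` of `K_m` encoded by `x`: it has all the vertices of `K_m`, and the
edge labelled `e` is present exactly when `x e = true`. -/
def graphOf {m : ℕ} (x : KEdge m → Bool) : SimpleGraph (Fin m) :=
  SimpleGraph.fromEdgeSet {e | ∃ he : e ∈ (⊤ : SimpleGraph (Fin m)).edgeSet, x ⟨e, he⟩ = true}

open Classical in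
/-- The set of inputs `x` for which `G_x` is a spanning tree of `K_m`. -/
noncomputable def spanningTrees (m : ℕ) : Finset (KEdge m → Bool) :=
  Finset.univ.filter fun x => (graphOf x).IsTree

open Classical in
/-- The density (probability mass function) of the uniform distribution over the inputs `x` for
which `G_x` is a spanning tree of `K_m`. -/
noncomputable def treeDensity (m : ℕ) (x : KEdge m → Bool) : ℝ :=
  if x ∈ spanningTrees m then 1 / ((spanningTrees m).card : ℝ) else 0

/-- `γ`, a real function of binary variables indexed by `V`, is a sum of `k` products
`g i * h i`, where `g i` and `h i` are non-negative real functions of complementary sets of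
variables `y i` and `z i`, each containing between a third and two thirds of all variables.
The sets may depend on `i`. -/
def IsBalancedProductSum {V : Type*} [Fintype V] [DecidableEq V]
    (γ : (V → Bool) → ℝ) (k : ℕ) : Prop :=
  ∃ (y z : Fin k → Finset V)
    (g : ∀ i, (↥(y i) → Bool) → ℝ) (h : ∀ i, (↥(z i) → Bool) → ℝ),
    (∀ i, (Fintype.card V : ℝ) / 3 ≤ ((y i).card : ℝ) ∧
      ((y i).card : ℝ) ≤ 2 * (Fintype.card V : ℝ) / 3) ∧
    (∀ i, (Fintype.card V : ℝ) / 3 ≤ ((z i).card : ℝ) ∧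
      ((z i).card : ℝ) ≤ 2 * (Fintype.card V : ℝ) / 3) ∧
    (∀ i, Disjoint (y i) (z i)) ∧
    (∀ i, y i ∪ z i = Finset.univ) ∧
    (∀ i u, 0 ≤ g i u) ∧
    (∀ i v, 0 ≤ h i v) ∧
    ∀ x : V → Bool, γ x = ∑ i, g i (fun e => x e) * h i (fun e => x e)

/-! Since the terms are non-negative, the supports of the products $g_ih_i$ are rectangles that
consist of spanning trees and together cover all of them. Colour the edges of $K_m$ red or blue by
the side of the partition they fall on. At a corner with $pq$ red and $pr$ blue, a rectangle cannot
have one tree containing the path $p,q,r$ and another containing $p,r,q$: mixing the two would give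
a tree with the triangle $pqr$ (`not_adj_and_adj_of_rectangle`). A balanced colouring has order
$m^3$ corners, so each rectangle excludes a constant fraction of all paths on three vertices
(`le_card_excluded_path`). By averaging, some such path is excluded by a constant fraction of the
rectangles. Repeating this on unused vertices yields a linear forest that all but a $(1-\delta)^t$
fraction of the rectangles exclude (`exists_isAcyclic_card_alive_le`). The forest extends to a
spanning tree, which some rectangle must cover, so $k\ge(1-\delta)^{-t}$ with $t$ linear in $m$. -/

/-! ### Corners of a two-coloured complete graph -/

open Finset in
open scoped Classical in
/-- Every ordered pair of a directed edge of `G` and a directed edge of its complement gives rise to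
a vertex incident with both graphs, and each such corner arises in few ways. -/
theorem card_adj_mul_card_compl_adj_le {V : Type*} [Fintype V] (G : SimpleGraph V) :
    #{e : V × V | G.Adj e.1 e.2} * #{e : V × V | Gᶜ.Adj e.1 e.2} ≤
      (2 * Fintype.card V + 1) * #{t : V × V × V | G.Adj t.1 t.2.1 ∧ Gᶜ.Adj t.1 t.2.2} := by
  -- If `a ≠ c`, the pair `ac` belongs to `G` or to `Gᶜ`, giving a corner at `c` or at `a` and
  -- leaving `b` or `d` free; if `a = c`, the two edges already form a corner. Hence the factor `2 *
  -- card V + 1`.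
  have h : ∀ a b c d : V, (if G.Adj a b then 1 else 0) * (if Gᶜ.Adj c d then 1 else 0) ≤
      (if G.Adj c a ∧ Gᶜ.Adj c d then 1 else 0) + (if G.Adj a b ∧ Gᶜ.Adj a c then 1 else 0) +
      (if a = c then (if G.Adj a b ∧ Gᶜ.Adj a d then 1 else 0) else 0) := by
    intro a b c d
    by_cases hac : a = c
    · subst hac
      by_cases h1 : G.Adj a b <;> by_cases h2 : Gᶜ.Adj a d <;> simp [h1, h2]
    · by_cases h1 : G.Adj a b <;> by_cases h2 : Gᶜ.Adj c d <;> by_cases h3 : G.Adj a c <;>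
        simp [h1, h2, h3, hac, G.adj_comm c a]
  simp_rw [card_filter, Fintype.sum_prod_type]
  calc
    _ = ∑ a, ∑ b, ∑ c, ∑ d, (if G.Adj a b then 1 else 0) * (if Gᶜ.Adj c d then 1 else 0) := by
      simp_rw [sum_mul, mul_sum]
    _ ≤ ∑ a, ∑ b, ∑ c, ∑ d, ((if G.Adj c a ∧ Gᶜ.Adj c d then 1 else 0) +
        (if G.Adj a b ∧ Gᶜ.Adj a c then 1 else 0) +
        (if a = c then (if G.Adj a b ∧ Gᶜ.Adj a d then 1 else 0) else 0)) := by
      gcongr with a _ b _ c _ d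
      exact h a b c d
    _ = _ := by
      have s1 : ∑ a, ∑ b : V, ∑ c, ∑ d, (if G.Adj c a ∧ Gᶜ.Adj c d then 1 else 0) =
          Fintype.card V * ∑ c, ∑ a, ∑ d, (if G.Adj c a ∧ Gᶜ.Adj c d then 1 else 0) := by
        simp only [sum_const, card_univ, smul_eq_mul]
        rw [← mul_sum, sum_comm]
      have s2 : ∑ a, ∑ b, ∑ c, ∑ d : V, (if G.Adj a b ∧ Gᶜ.Adj a c then 1 else 0) =
          Fintype.card V * ∑ a, ∑ b, ∑ c, (if G.Adj a b ∧ Gᶜ.Adj a c then 1 else 0) := by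
        simp only [sum_const, card_univ, smul_eq_mul, mul_sum]
      have s3 : ∑ a, ∑ b, ∑ c, ∑ d,
          (if a = c then (if G.Adj a b ∧ Gᶜ.Adj a d then 1 else 0) else 0) =
          ∑ a, ∑ b, ∑ d, (if G.Adj a b ∧ Gᶜ.Adj a d then 1 else 0) := by
        refine sum_congr rfl fun a _ => sum_congr rfl fun b _ => ?_
        rw [sum_comm]
        simp
      simp_rw [sum_add_distrib]
      rw [s1, s2, s3]
      ring

open Finset in
open scoped Classical in
theorem card_adj_eq_two_mul_card_edgeSet {V : Type*} [Fintype V] (G : SimpleGraph V) :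
    #{e : V × V | G.Adj e.1 e.2} = 2 * #G.edgeFinset := by
  rw [← G.sum_degrees_eq_twice_card_edges, card_filter, Fintype.sum_prod_type]
  refine sum_congr rfl fun a _ => ?_
  rw [← card_filter, ← G.card_neighborFinset_eq_degree, G.neighborFinset_eq_filter]

open Finset in
open scoped Classical in
/-- If every corner `p; q, r` has one of the orders `(p, q, r)`, `(p, r, q)` satisfying `bad`, then
there are at least as many bad triples as corners. -/
theorem card_corner_le_card_bad {V : Type*} [Fintype V] (G : SimpleGraph V)
    (bad : V → V → V → Prop)
    (h : ∀ p q r, G.Adj p q → Gᶜ.Adj p r → bad p q r ∨ bad p r q) :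
    #{t : V × V × V | G.Adj t.1 t.2.1 ∧ Gᶜ.Adj t.1 t.2.2} ≤
      #{t : V × V × V | bad t.1 t.2.1 t.2.2} := by
  -- A swap is never confused with a non-swap: only one of `q`, `r` is a `G`-neighbour of `p`.
  refine card_le_card_of_injOn
    (fun t => if bad t.1 t.2.1 t.2.2 then t else (t.1, t.2.2, t.2.1)) ?_ ?_
  · rintro ⟨p, q, r⟩ ht
    simp only [coe_filter, mem_univ, true_and, Set.mem_ofPred_eq] at ht ⊢
    have := h p q r ht.1 ht.2
    split_ifs with hb
    · exact hb
    · exact this.resolve_left hb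
  · rintro ⟨p, q, r⟩ ht ⟨p', q', r'⟩ ht' heq
    simp only [coe_filter, mem_univ, true_and, Set.mem_ofPred_eq, SimpleGraph.compl_adj]
      at ht ht' heq
    split_ifs at heq <;> simp only [Prod.mk.injEq] at heq ⊢ <;> obtain ⟨rfl, rfl, rfl⟩ := heq
    · simp
    · exact absurd ht.1 ht'.2.2
    · exact absurd ht'.1 ht.2.2
    · simp

open Finset in
open scoped Classical in
theorem card_triple_meeting_le {V : Type*} [Fintype V] (S : Finset V) :
    #{t : V × V × V | t.1 ∈ S ∨ t.2.1 ∈ S ∨ t.2.2 ∈ S} ≤ 3 * (#S * Fintype.card V ^ 2) := by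
  have hsub : ({t : V × V × V | t.1 ∈ S ∨ t.2.1 ∈ S ∨ t.2.2 ∈ S} : Finset (V × V × V)) ⊆
      (S ×ˢ univ ×ˢ univ) ∪ ((univ ×ˢ S ×ˢ univ) ∪ (univ ×ˢ univ ×ˢ S)) := by
    intro t
    simp
  calc
    _ ≤ _ := card_le_card hsub
    _ ≤ _ := (card_union_le _ _).trans (Nat.add_le_add_left (card_union_le _ _) _)
    _ = _ := by
      simp only [card_product, card_univ]
      ring

/-! ### Greedy choice of a forest -/

/-- Adding a path on three isolated vertices to an acyclic graph keeps it acyclic. -/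
theorem SimpleGraph.IsAcyclic.sup_edge_sup_edge {V : Type*} {F : SimpleGraph V} (hF : F.IsAcyclic)
    {p q r : V} (hpq : p ≠ q) (hqr : q ≠ r) (hpr : p ≠ r)
    (hp : ∀ v, ¬F.Adj p v) (hr : ∀ v, ¬F.Adj r v) :
    (F ⊔ SimpleGraph.edge p q ⊔ SimpleGraph.edge q r).IsAcyclic := by
  have key : ∀ (H : SimpleGraph V) (a b : V), a ≠ b → (∀ v, ¬H.Adj a v) → ¬H.Reachable a b := by
    rintro H a b hab ha ⟨w⟩
    cases w with
    | nil => exact hab rfl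
    | cons h _ => exact ha _ h
  refine (hF.sup_edge_of_not_reachable (key F p q hpq hp)).sup_edge_of_not_reachable
    fun h => key _ r q hqr.symm (fun v => ?_) h.symm
  simp only [SimpleGraph.sup_adj, SimpleGraph.edge_adj, not_or]
  refine ⟨hr v, ?_⟩
  rintro ⟨⟨h, _⟩ | ⟨h, _⟩, _⟩
  · exact hpr h.symm
  · exact hqr h.symm

open Finset in
open scoped Classical in
/-- Greedy choice of a linear forest: if each of the families `P i` of graphs excludes many paths on
three vertices, some acyclic graph is contained in members of few of the families. -/
theorem exists_isAcyclic_card_alive_le {V ι : Type*} [Fintype V] [Nonempty V]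
    [Fintype ι] (P : ι → SimpleGraph V → Prop) (β δ : ℝ) (hδ0 : 0 < δ)
    (hδ : δ ≤ 1)
    (hbad : ∀ i, β ≤ #{t : V × V × V | (t.1 ≠ t.2.1 ∧ t.2.1 ≠ t.2.2 ∧ t.1 ≠ t.2.2) ∧
      ∀ T, P i T → ¬(T.Adj t.1 t.2.1 ∧ T.Adj t.2.1 t.2.2)}) (t : ℕ)
    (ht : ∀ j < t, δ * (Fintype.card V : ℝ) ^ 3 + 9 * j * (Fintype.card V : ℝ) ^ 2 ≤ β) :
    ∃ (F : SimpleGraph V) (S : Finset V), F.IsAcyclic ∧ (∀ a ∉ S, ∀ b, ¬F.Adj a b) ∧ #S ≤ 3 * t ∧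
      (#{i | ∃ T, P i T ∧ F ≤ T} : ℝ) ≤ (1 - δ) ^ t * Fintype.card ι := by
  induction t with
  | zero =>
    refine ⟨⊥, ∅, SimpleGraph.isAcyclic_bot, by simp, by simp, ?_⟩
    simpa using card_le_univ _
  | succ t ih =>
    obtain ⟨F, S, hF, hS, hcard, halive⟩ := ih fun j hj => ht j (hj.trans t.lt_succ_self)
    set A : Finset ι := {i | ∃ T, P i T ∧ F ≤ T} with hA
    rcases A.eq_empty_or_nonempty with hA0 | hA0
    · refine ⟨F, S, hF, hS, by omega, ?_⟩
      rw [← hA, hA0]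
      have : (0 : ℝ) ≤ 1 - δ := by linarith
      simpa using by positivity
    let bad : ι → V × V × V → Prop := fun i t =>
      (t.1 ≠ t.2.1 ∧ t.2.1 ≠ t.2.2 ∧ t.1 ≠ t.2.2) ∧
        ∀ T, P i T → ¬(T.Adj t.1 t.2.1 ∧ T.Adj t.2.1 t.2.2)
    let free : V × V × V → Prop := fun t => t.1 ∉ S ∧ t.2.1 ∉ S ∧ t.2.2 ∉ S
    have hi : ∀ i, δ * (Fintype.card V : ℝ) ^ 3 ≤ (#{t | free t ∧ bad i t} : ℝ) := by
      intro i
      have h1 : #{t | bad i t} ≤ #{t | free t ∧ bad i t} +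
          #{t : V × V × V | t.1 ∈ S ∨ t.2.1 ∈ S ∨ t.2.2 ∈ S} := by
        refine (card_le_card ?_).trans (card_union_le _ _)
        intro t
        simp only [mem_filter, mem_union, mem_univ, true_and, free]
        tauto
      have h2 := card_triple_meeting_le S
      have h3 : #S * Fintype.card V ^ 2 ≤ 3 * t * Fintype.card V ^ 2 := Nat.mul_le_mul_right _ hcard
      -- The `3 * t` used vertices spoil at most `3 * (3 * t) * card V ^ 2` triples.
      have h4 : #{t | bad i t} ≤ #{t | free t ∧ bad i t} + 9 * t * Fintype.card V ^ 2 := by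
        linarith
      have h5 : (#{t | bad i t} : ℝ) ≤
          #{t | free t ∧ bad i t} + 9 * t * (Fintype.card V : ℝ) ^ 2 := by
        exact_mod_cast h4
      linarith [ht t t.lt_succ_self, (hbad i : β ≤ (#{t | bad i t} : ℝ))]
    -- Double counting of pairs (alive family, bad triple) over at most `card V ^ 3` triples. The
    -- middle clause is kept because it makes the three vertices distinct.
    have hex : ∃ τ, free τ ∧ (∃ i, bad i τ) ∧ δ * #A ≤ (#{i ∈ A | bad i τ} : ℝ) := by
      by_contra! hcon
      set X : Finset (V × V × V) := {τ | free τ ∧ ∃ i, bad i τ} with hX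
      have hV : (0 : ℝ) < (Fintype.card V : ℝ) ^ 3 := by
        have : 0 < Fintype.card V := Fintype.card_pos
        positivity
      have hXne : X.Nonempty := by
        obtain ⟨i, -⟩ := hA0
        have h0 : (0 : ℝ) < #{t | free t ∧ bad i t} := (mul_pos hδ0 hV).trans_le (hi i)
        obtain ⟨τ, hτ⟩ := card_pos.1 (Nat.cast_pos.1 h0)
        simp only [mem_filter, mem_univ, true_and] at hτ
        exact ⟨τ, by simpa [hX] using ⟨hτ.1, i, hτ.2⟩⟩
      have hswap : ∑ i ∈ A, #{t | free t ∧ bad i t} = ∑ τ ∈ X, #{i ∈ A | bad i τ} := by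
        refine Eq.trans (sum_congr rfl fun i _ => congrArg card ?_)
          (sum_card_bipartiteAbove_eq_sum_card_bipartiteBelow (s := A) (t := X) bad)
        ext τ
        simp only [mem_filter, mem_univ, true_and, bipartiteAbove, hX]
        exact ⟨fun h => ⟨⟨h.1, i, h.2⟩, h.2⟩, fun h => ⟨h.1.1, h.2⟩⟩
      have hlow : #A * (δ * (Fintype.card V : ℝ) ^ 3) ≤
          ∑ i ∈ A, (#{t | free t ∧ bad i t} : ℝ) := by
        rw [← nsmul_eq_mul]
        exact card_nsmul_le_sum _ _ _ fun i _ => hi i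
      have hup : ∑ τ ∈ X, (#{i ∈ A | bad i τ} : ℝ) < #X * (δ * #A) := by
        rw [← nsmul_eq_mul, ← sum_const]
        refine sum_lt_sum_of_nonempty hXne fun τ hτ => ?_
        simp only [hX, mem_filter, mem_univ, true_and] at hτ
        exact hcon τ hτ.1 hτ.2
      have hXcard : (#X : ℝ) ≤ (Fintype.card V : ℝ) ^ 3 := by
        have h := card_le_univ X
        simp only [Fintype.card_prod] at h
        calc (#X : ℝ) ≤ _ := Nat.cast_le.2 h
          _ = _ := by push_cast; ring
      have hup' := mul_le_mul_of_nonneg_right hXcard (mul_nonneg hδ0.le (Nat.cast_nonneg #A))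
      have hswap' : ∑ i ∈ A, (#{t | free t ∧ bad i t} : ℝ) =
          ∑ τ ∈ X, (#{i ∈ A | bad i τ} : ℝ) := by exact_mod_cast hswap
      linarith
    obtain ⟨⟨p, q, r⟩, ⟨hp, hq, hr⟩, ⟨i₀, ⟨hpq, hqr, hpr⟩, -⟩, hτ⟩ := hex
    dsimp only at hp hq hr hpq hqr hpr
    refine ⟨F ⊔ SimpleGraph.edge p q ⊔ SimpleGraph.edge q r, S ∪ {p, q, r},
      hF.sup_edge_sup_edge hpq hqr hpr (hS p hp) (hS r hr), ?_, ?_, ?_⟩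
    · intro a ha b
      simp only [mem_union, mem_insert, mem_singleton, not_or] at ha
      simp only [SimpleGraph.sup_adj, SimpleGraph.edge_adj, not_or]
      refine ⟨⟨hS a ha.1 b, ?_⟩, ?_⟩ <;> tauto
    · have h3 : #({p, q, r} : Finset V) ≤ 3 := card_le_three
      have := card_union_le S {p, q, r}
      omega
    · have hsub : ({i | ∃ T, P i T ∧ F ⊔ SimpleGraph.edge p q ⊔ SimpleGraph.edge q r ≤ T} :
          Finset ι) ⊆ {i ∈ A | ¬bad i (p, q, r)} := by
        intro i
        simp only [mem_filter, mem_univ, true_and, hA]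
        rintro ⟨T, hT, hle⟩
        refine ⟨⟨T, hT, (le_sup_left.trans le_sup_left).trans hle⟩, fun hb => ?_⟩
        exact hb.2 T hT ⟨hle (by simp [SimpleGraph.edge_adj, hpq]),
          hle (by simp [SimpleGraph.edge_adj, hqr])⟩
      have h1 := card_le_card hsub
      have h2 := card_filter_add_card_filter_not (s := A) (fun i => bad i (p, q, r))
      have h1' : (#{i | ∃ T, P i T ∧ F ⊔ SimpleGraph.edge p q ⊔ SimpleGraph.edge q r ≤ T} : ℝ) ≤
        #{i ∈ A | ¬bad i (p, q, r)} := by exact_mod_cast h1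
      have h2' : (#{i ∈ A | bad i (p, q, r)} : ℝ) + #{i ∈ A | ¬bad i (p, q, r)} = #A := by
        exact_mod_cast h2
      calc
        _ ≤ (1 - δ) * (#A : ℝ) := by linarith
        _ ≤ (1 - δ) * ((1 - δ) ^ t * Fintype.card ι) :=
          mul_le_mul_of_nonneg_left halive (by linarith)
        _ = _ := by ring

open scoped Classical in
/-- If families `P i` cover all spanning trees, but each excludes many paths on three vertices, then
there are many of them. -/
theorem one_le_pow_mul_card_of_cover {V ι : Type*} [Fintype V] [Nonempty V] [Fintype ι]
    (P : ι → SimpleGraph V → Prop) (hP : ∀ T : SimpleGraph V, T.IsTree → ∃ i, P i T)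
    (β δ : ℝ) (hδ0 : 0 < δ) (hδ : δ ≤ 1)
    (hbad : ∀ i, β ≤ Finset.card {t : V × V × V | (t.1 ≠ t.2.1 ∧ t.2.1 ≠ t.2.2 ∧ t.1 ≠ t.2.2) ∧
      ∀ T, P i T → ¬(T.Adj t.1 t.2.1 ∧ T.Adj t.2.1 t.2.2)}) (t : ℕ)
    (ht : ∀ j < t, δ * (Fintype.card V : ℝ) ^ 3 + 9 * j * (Fintype.card V : ℝ) ^ 2 ≤ β) :
    1 ≤ (1 - δ) ^ t * Fintype.card ι := by
  obtain ⟨F, -, hF, -, -, halive⟩ := exists_isAcyclic_card_alive_le P β δ hδ0 hδ hbad t ht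
  obtain ⟨T, hFT, -, hT⟩ :=
    SimpleGraph.connected_top.exists_isTree_le_of_le_of_isAcyclic le_top hF
  obtain ⟨i, hi⟩ := hP T hT
  refine le_trans (Nat.one_le_cast.2 (Finset.one_le_card.2 ⟨i, ?_⟩)) halive
  simpa using ⟨T, hi, hFT⟩

/-! ### Rectangles of spanning trees -/

theorem graphOf_adj {m : ℕ} (x : KEdge m → Bool) (a b : Fin m) :
    (graphOf x).Adj a b ↔ ∃ h : s(a, b) ∈ (⊤ : SimpleGraph (Fin m)).edgeSet,
      x ⟨s(a, b), h⟩ = true := by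
  simp only [graphOf, SimpleGraph.fromEdgeSet_adj, Set.mem_ofPred_eq]
  exact ⟨fun h => h.1, fun h => ⟨h, h.1⟩⟩

theorem exists_graphOf_eq {m : ℕ} (T : SimpleGraph (Fin m)) : ∃ x, graphOf x = T := by
  classical
  refine ⟨fun e => decide (e.1 ∈ T.edgeSet), ?_⟩
  ext a b
  rw [graphOf_adj]
  simp only [decide_eq_true_eq, SimpleGraph.mem_edgeSet]
  exact ⟨fun h => h.2, fun h => ⟨h.ne, h⟩⟩

theorem SimpleGraph.IsTree.not_triangle {V : Type*} {T : SimpleGraph V} (hT : T.IsTree) {a b c : V}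
    (hab : T.Adj a b) (hbc : T.Adj b c) (hac : T.Adj a c) : False := by
  classical
  exact hT.isAcyclic.cliqueFree le_rfl {a, b, c} (SimpleGraph.is3Clique_triple_iff.2 ⟨hab, hac, hbc⟩)

/-- In a rectangle of spanning trees, a corner with edges on both sides of the bipartition `Y`, `Yᶜ`
of the edges determines a path on three vertices that no tree of the rectangle contains. -/
theorem not_adj_and_adj_of_rectangle {m : ℕ} (R : (KEdge m → Bool) → Prop) (Y : Finset (KEdge m))
    (hR : ∀ x, R x → (graphOf x).IsTree)
    (hrect : ∀ x x', R x → R x' → R fun e => if e ∈ Y then x e else x' e)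
    {p q r : Fin m} (hpq : (graphOf fun e => decide (e ∈ Y)).Adj p q)
    (hpr : (graphOf fun e => decide (e ∈ Y))ᶜ.Adj p r) :
    (∀ x, R x → ¬((graphOf x).Adj p q ∧ (graphOf x).Adj q r)) ∨
      ∀ x, R x → ¬((graphOf x).Adj p r ∧ (graphOf x).Adj r q) := by
  set G := graphOf fun e => decide (e ∈ Y) with hG
  by_contra! hcon
  obtain ⟨⟨x, hx, hxpq, hxqr⟩, x', hx', hxpr, hxrq⟩ := hcon
  have hin : ∀ a b, G.Adj a b → (graphOf x).Adj a b →
      (graphOf fun e => if e ∈ Y then x e else x' e).Adj a b := by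
    intro a b h1 h2
    rw [hG, graphOf_adj] at h1
    rw [graphOf_adj] at h2 ⊢
    obtain ⟨h, h1⟩ := h1
    refine ⟨h, ?_⟩
    rw [if_pos (of_decide_eq_true h1)]
    exact h2.2
  have hout : ∀ a b, ¬G.Adj a b → (graphOf x').Adj a b →
      (graphOf fun e => if e ∈ Y then x e else x' e).Adj a b := by
    intro a b h1 h2
    rw [hG, graphOf_adj] at h1
    rw [graphOf_adj] at h2 ⊢
    obtain ⟨h, h2⟩ := h2
    refine ⟨h, ?_⟩
    rw [if_neg fun hY => h1 ⟨h, decide_eq_true hY⟩]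
    exact h2
  refine (hR _ (hrect x x' hx hx')).not_triangle (hin p q hpq hxpq) ?_ (hout p r hpr.2 hxpr)
  -- Both trees contain `qr`, so the mixed one does, whichever side `qr` is on.
  by_cases h : G.Adj q r
  · exact hin q r h hxqr
  · exact hout q r h hxrq.symm

open Finset in
open scoped Classical in
theorem card_edgeFinset_graphOf_decide {m : ℕ} (Y : Finset (KEdge m)) :
    #(graphOf fun e => decide (e ∈ Y)).edgeFinset = #Y := by
  rw [← card_map (Function.Embedding.subtype _)]
  congr 1
  ext e
  induction e with
  | h a b =>
    rw [SimpleGraph.mem_edgeFinset, SimpleGraph.mem_edgeSet, graphOf_adj]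
    simp

open Finset in
open scoped Classical in
/-- A rectangle of spanning trees with respect to a balanced bipartition of the edges of `K_m`
excludes a constant fraction of the paths on three vertices. -/
theorem le_card_excluded_path {m : ℕ} (hm : 20 ≤ m) (R : (KEdge m → Bool) → Prop)
    (Y : Finset (KEdge m)) (hY : (Fintype.card (KEdge m) : ℝ) / 3 ≤ #Y)
    (hY' : (#Y : ℝ) ≤ 2 * (Fintype.card (KEdge m) : ℝ) / 3)
    (hR : ∀ x, R x → (graphOf x).IsTree)
    (hrect : ∀ x x', R x → R x' → R fun e => if e ∈ Y then x e else x' e) :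
    (9 / 100) * (m : ℝ) ^ 3 ≤ #{t : Fin m × Fin m × Fin m |
      (t.1 ≠ t.2.1 ∧ t.2.1 ≠ t.2.2 ∧ t.1 ≠ t.2.2) ∧
      ∀ T, (∃ x, R x ∧ graphOf x = T) → ¬(T.Adj t.1 t.2.1 ∧ T.Adj t.2.1 t.2.2)} := by
  set G := graphOf fun e => decide (e ∈ Y) with hG
  have h1 : #{e : Fin m × Fin m | G.Adj e.1 e.2} * #{e : Fin m × Fin m | Gᶜ.Adj e.1 e.2} ≤
      (2 * Fintype.card (Fin m) + 1) *
        #{t : Fin m × Fin m × Fin m | G.Adj t.1 t.2.1 ∧ Gᶜ.Adj t.1 t.2.2} := by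
    convert card_adj_mul_card_compl_adj_le G
  have h2 : #{t : Fin m × Fin m × Fin m | G.Adj t.1 t.2.1 ∧ Gᶜ.Adj t.1 t.2.2} ≤
      #{t : Fin m × Fin m × Fin m | (t.1 ≠ t.2.1 ∧ t.2.1 ≠ t.2.2 ∧ t.1 ≠ t.2.2) ∧
        ∀ T, (∃ x, R x ∧ graphOf x = T) → ¬(T.Adj t.1 t.2.1 ∧ T.Adj t.2.1 t.2.2)} := by
    convert card_corner_le_card_bad G (fun a b c => (a ≠ b ∧ b ≠ c ∧ a ≠ c) ∧
      ∀ T, (∃ x, R x ∧ graphOf x = T) → ¬(T.Adj a b ∧ T.Adj b c)) ?_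
    intro p q r hpq hpr
    have hqr : q ≠ r := by
      rintro rfl
      exact hpr.2 hpq
    rcases not_adj_and_adj_of_rectangle R Y hR hrect hpq hpr with h | h
    · refine Or.inl ⟨⟨hpq.ne, hqr, hpr.ne⟩, ?_⟩
      rintro _ ⟨x, hx, rfl⟩
      exact h x hx
    · refine Or.inr ⟨⟨hpr.ne, hqr.symm, hpq.ne⟩, ?_⟩
      rintro _ ⟨x, hx, rfl⟩
      exact h x hx
  have hn : Fintype.card (KEdge m) = m.choose 2 := by
    rw [← SimpleGraph.edgeFinset_card, SimpleGraph.card_edgeFinset_top_eq_card_choose_two,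
      Fintype.card_fin]
  have hn' : (Fintype.card (KEdge m) : ℝ) = m * (m - 1) / 2 := by
    rw [hn, Nat.cast_choose_two]
  have hr : #{e : Fin m × Fin m | G.Adj e.1 e.2} = 2 * #Y := by
    rw [card_adj_eq_two_mul_card_edgeSet, hG, card_edgeFinset_graphOf_decide]
  have hb : #{e : Fin m × Fin m | Gᶜ.Adj e.1 e.2} + 2 * #Y = 2 * Fintype.card (KEdge m) := by
    have hGc : Gᶜ = graphOf fun e => decide (e ∈ Yᶜ) := by
      ext a b
      rw [SimpleGraph.compl_adj, hG, graphOf_adj, graphOf_adj]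
      simp only [decide_eq_true_eq, mem_compl, not_exists]
      exact ⟨fun h => ⟨h.1, h.2 h.1⟩, fun ⟨h, h'⟩ => ⟨h, fun _ => h'⟩⟩
    have hc : #{e : Fin m × Fin m | Gᶜ.Adj e.1 e.2} = 2 * #Yᶜ := by
      rw [← card_edgeFinset_graphOf_decide, ← card_adj_eq_two_mul_card_edgeSet]
      convert rfl
      exact hGc.symm
    rw [hc, ← mul_add, card_compl_add_card]
  rw [hr, Fintype.card_fin] at h1
  have h3 := h1.trans (Nat.mul_le_mul_left _ h2)
  have h3' := (Nat.cast_le (α := ℝ)).2 h3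
  simp only [Nat.cast_mul, Nat.cast_add, Nat.cast_ofNat, Nat.cast_one] at h3'
  have hb' : (#{e : Fin m × Fin m | Gᶜ.Adj e.1 e.2} : ℝ) + 2 * #Y =
      2 * Fintype.card (KEdge m) := by
    exact_mod_cast hb
  have hm' : (20 : ℝ) ≤ m := by exact_mod_cast hm
  -- With `N` edges in all, `#Y * (N - #Y)` is least at the ends of the balanced range, where it
  -- equals `2 * N ^ 2 / 9`.
  have h4 : (2 / 9) * ((m : ℝ) * (m - 1)) ^ 2 ≤
      (2 * #Y : ℝ) * #{e : Fin m × Fin m | Gᶜ.Adj e.1 e.2} := by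
    rw [hn'] at hY hY' hb'
    rw [eq_sub_of_add_eq hb']
    nlinarith [mul_nonneg (sub_nonneg.2 hY) (sub_nonneg.2 hY')]
  refine le_of_mul_le_mul_left (le_trans ?_ (h4.trans h3')) (by positivity : (0 : ℝ) < 2 * m + 1)
  have h5 : (0 : ℝ) ≤ m ^ 2 := by positivity
  -- The bound `20 ≤ m` absorbs the lower-order terms, as `2 * 9 / 100 < 2 / 9`.
  have h6 : (2 * (m : ℝ) + 1) * ((9 / 100) * m) ≤ (2 / 9) * (m - 1) ^ 2 := by nlinarith
  calc (2 * (m : ℝ) + 1) * (9 / 100 * (m : ℝ) ^ 3)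
      = (m : ℝ) ^ 2 * ((2 * (m : ℝ) + 1) * ((9 / 100) * m)) := by ring
    _ ≤ (m : ℝ) ^ 2 * ((2 / 9) * ((m : ℝ) - 1) ^ 2) := mul_le_mul_of_nonneg_left h6 h5
    _ = _ := by ring

/-! ### Numerical bound and conclusion -/

/-- There is slack: the power is at most $e^{-9m/40000}$, and $9/40000>1/15120$. -/
theorem two_rpow_mul_one_sub_pow_le_one {m t : ℕ} (ht : (m : ℝ) / 200 ≤ t) :
    (2 : ℝ) ^ ((m : ℝ) / 15120) * (1 - 9 / 200) ^ t ≤ 1 := by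
  have h1 : (1 - 9 / 200 : ℝ) ^ t ≤ Real.exp (-((9 / 200) * t)) := by
    calc (1 - 9 / 200 : ℝ) ^ t ≤ Real.exp (-(9 / 200)) ^ t :=
          pow_le_pow_left₀ (by norm_num) (Real.one_sub_le_exp_neg _) t
      _ = _ := by
        rw [← Real.exp_nat_mul]
        ring_nf
  have h2 : (2 : ℝ) ^ ((m : ℝ) / 15120) ≤ Real.exp ((m : ℝ) / 15120) := by
    rw [Real.rpow_def_of_pos two_pos]
    refine Real.exp_le_exp.2 (mul_le_of_le_one_left (by positivity) ?_)
    linarith [Real.log_two_lt_d9]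
  calc _ ≤ Real.exp ((m : ℝ) / 15120) * Real.exp (-((9 / 200) * t)) :=
        mul_le_mul h2 h1 (by norm_num) (Real.exp_pos _).le
    _ ≤ 1 := by
      rw [← Real.exp_add, Real.exp_le_one_iff]
      have : (0 : ℝ) ≤ m := Nat.cast_nonneg m
      linarith

theorem mainTheorem2 (m : ℕ) (hm : 20 ≤ m) (c : ℝ) (hc : 0 < c) (k : ℕ)
    (hd : IsBalancedProductSum (fun x : KEdge m → Bool => c * treeDensity m x) k) :
    (2 : ℝ) ^ ((m : ℝ) / 15120) ≤ (k : ℝ) := by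
  classical
  obtain ⟨y, z, g, h, hy, -, hdisj, -, hg, hh, hsum⟩ := hd
  beta_reduce at hsum
  have hpos : ∀ x : KEdge m → Bool, 0 < c * treeDensity m x ↔ (graphOf x).IsTree := by
    intro x
    have hmem : x ∈ spanningTrees m ↔ (graphOf x).IsTree := by simp [spanningTrees]
    rw [← hmem, treeDensity]
    split_ifs with hx
    · have : 0 < (spanningTrees m).card := Finset.card_pos.2 ⟨x, hx⟩
      simp only [hx, iff_true]
      positivity
    · simp [hx]
  let R : Fin k → (KEdge m → Bool) → Prop := fun i x =>
    0 < g i (fun e => x e) ∧ 0 < h i (fun e => x e)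
  have hR : ∀ i x, R i x → (graphOf x).IsTree := by
    intro i x hx
    rw [← hpos, hsum x]
    exact Finset.sum_pos' (fun i _ => mul_nonneg (hg i _) (hh i _))
      ⟨i, Finset.mem_univ i, mul_pos hx.1 hx.2⟩
  have hcover : ∀ x, (graphOf x).IsTree → ∃ i, R i x := by
    intro x hx
    rw [← hpos, hsum x] at hx
    obtain ⟨i, -, hi⟩ := Finset.exists_lt_of_sum_lt (f := fun _ => (0 : ℝ)) (by simpa using hx)
    exact ⟨i, pos_of_mul_pos_left hi (hh i _), pos_of_mul_pos_right hi (hg i _)⟩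
  have hrect : ∀ i x x', R i x → R i x' → R i fun e => if e ∈ y i then x e else x' e := by
    intro i x x' hx hx'
    have h1 : (fun e : y i => if (e : KEdge m) ∈ y i then x e else x' e) =
        fun e : y i => x e :=
      funext fun e => if_pos e.2
    have h2 : (fun e : z i => if (e : KEdge m) ∈ y i then x e else x' e) =
        fun e : z i => x' e :=
      funext fun e => if_neg (Finset.disjoint_right.1 (hdisj i) e.2)
    refine ⟨?_, ?_⟩
    · rw [h1]
      exact hx.1
    · rw [h2]
      exact hx'.2
  have : Nonempty (Fin m) := ⟨⟨0, by omega⟩⟩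
  have hone := one_le_pow_mul_card_of_cover (fun i T => ∃ x, R i x ∧ graphOf x = T)
    (fun T hT => by
      obtain ⟨x, rfl⟩ := exists_graphOf_eq T
      obtain ⟨i, hi⟩ := hcover x hT
      exact ⟨i, x, hi, rfl⟩)
    -- Here `δ` takes half of the excluded fraction; the other half pays for the used vertices, `9 *
    -- j * m ^ 2`, as long as `j ≤ m / 200`.
    ((9 / 100) * (m : ℝ) ^ 3) (9 / 200) (by norm_num) (by norm_num)
    (fun i => by
      convert le_card_excluded_path hm (R i) (y i) (hy i).1 (hy i).2 (hR i) (hrect i))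
    ⌈(m : ℝ) / 200⌉₊ (by
      intro j hj
      rw [Nat.lt_ceil] at hj
      rw [Fintype.card_fin]
      nlinarith [mul_le_mul_of_nonneg_right hj.le (by positivity : (0 : ℝ) ≤ (m : ℝ) ^ 2)])
  rw [Fintype.card_fin] at hone
  have hpow := two_rpow_mul_one_sub_pow_le_one (Nat.le_ceil ((m : ℝ) / 200))
  generalize (1 - 9 / 200 : ℝ) ^ ⌈(m : ℝ) / 200⌉₊ = b at hone hpow
  have h2 : (0 : ℝ) < 2 ^ ((m : ℝ) / 15120) := by positivity
  generalize (2 : ℝ) ^ ((m : ℝ) / 15120) = a at h2 hpow ⊢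
  calc a ≤ a * (b * k) := le_mul_of_one_le_right h2.le hone
    _ = a * b * k := by ring
    _ ≤ k := mul_le_of_le_one_left (Nat.cast_nonneg k) hpow
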